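/- Let $\mathbb{K}$ be $\mathbb{R}$ or $\mathbb{C}$. For a Banach space $X$ over $\mathbb{K}$, a weak$^*$-compact set $K\subseteq X^*$ and $\varepsilon>0$, let $s_\varepsilon(K)$ be the set of those $x^*\in K$ such that $\operatorname{diam}(V\cap K)>\varepsilon$ (norm diameter) for every weak$^*$-neighbourhood $V$ of $x^*$. Put $s^0_\varepsilon(K)=K$, $s^{\zeta+1}_\varepsilon(K)=s_\varepsilon(s^\zeta_\varepsilon(K))$, and $s^\zeta_\varepsilon(K)=\bigcap_{\eta<\zeta}s^\eta_\varepsilon(K)$ for limit ordinals $\zeta$. Let $Sz(K,\varepsilon)$ be the least ordinal $\zeta$ with $s^\zeta_\varepsilon(K)=\varnothing$ ($\infty$ if there is none) and $Sz(K)=\sup_{\varepsilon>0}Sz(K,\varepsilon)$. The Szlenk index of a bounded linear operator $A:X\to Y$ between Banach spaces is $Sz(A)=Sz(A^*B_{Y^*})$, where $B_{Y^*}$ is the closed unit ball of $Y^*$. **Theorem.** For every ordinal $\xi$, the class $\mathfrak{D}_\xi$ of all bounded linear operators $A$ between Banach spaces over $\mathbb{K}$ with $Sz(A)\leqslant\omega^\xi$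 is a closed operator ideal. That is, writing $\mathfrak{D}_\xi(X,Y)$ for the set of operators from $X$ to $Y$ in $\mathfrak{D}_\xi$: 1. if $C:W\to X$, $B:X\to Y$ and $A:Y\to Z$ are bounded linear operators between Banach spaces and $B\in\mathfrak{D}_\xi$, then $ABC\in\mathfrak{D}_\xi$; 2. the identity $I_{\mathbb{K}}$ of the scalar field belongs to $\mathfrak{D}_\xi$; 3. for all Banach spaces $X,Y$, the set $\mathfrak{D}_\xi(X,Y)$ is a linear subspace of the space $\mathfrak{L}(X,Y)$ of all bounded linear operators from $X$ to $Y$, and it is closed in the operator norm. -/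

import Mathlib

universe u v w

noncomputable section

open Set Topology
open scoped Ordinal

namespace Szlenk

section Derivation

variable {𝕜 : Type w} [RCLike 𝕜] {X : Type u} [NormedAddCommGroup X] [NormedSpace 𝕜 X]

/-- The set `s_ε(K)` of all `x ∈ K` such that every weak* neighbourhood `V` of `x` satisfies
`diam (V ∩ K) > ε`, the diameter being taken in the norm of the dual space. It is extended by
`s_ε(K) = K` for `ε ≤ 0`. -/
def derivSet (ε : ℝ) (K : Set (StrongDual 𝕜 X)) : Set (StrongDual 𝕜 X) :=
  {x ∈ K | 0 < ε → ∀ V ∈ 𝓝 (StrongDual.toWeakDual x),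
    ENNReal.ofReal ε < Metric.ediam (StrongDual.toWeakDual ⁻¹' V ∩ K)}

/-- The transfinite derivations: `s^0_ε(K) = K`, `s^{ζ+1}_ε(K) = s_ε(s^ζ_ε(K))`, and
`s^ζ_ε(K) = ⋂_{η < ζ} s^η_ε(K)` for a limit ordinal `ζ`. -/
def iterDeriv (ε : ℝ) (K : Set (StrongDual 𝕜 X)) (ζ : Ordinal.{v}) : Set (StrongDual 𝕜 X) :=
  Ordinal.limitRecOn (motive := fun _ => Set (StrongDual 𝕜 X)) ζ
    K
    (fun _ S => derivSet ε S)
    (fun ζ _ S => ⋂ (η : Ordinal.{v}) (h : η < ζ), S η h)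

/-- `Sz(K, ε)`: the least ordinal `ζ` with `s^ζ_ε(K) = ∅`, and `⊤` (that is, `∞`) if there is
none. -/
def indexAt (K : Set (StrongDual 𝕜 X)) (ε : ℝ) : WithTop Ordinal.{v} :=
  sInf ((fun ζ : Ordinal.{v} => (ζ : WithTop Ordinal.{v})) ''
    {ζ : Ordinal.{v} | iterDeriv ε K ζ = ∅})

/-- The Szlenk index `Sz(K) = sup_{ε > 0} Sz(K, ε)`. -/
def index (K : Set (StrongDual 𝕜 X)) : WithTop Ordinal.{v} :=
  ⨆ (ε : ℝ) (_ : 0 < ε), indexAt.{u, v, w} K ε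

variable {Y : Type u} [NormedAddCommGroup Y] [NormedSpace 𝕜 Y]

/-- The set `A^* B_{Y^*}`, the image under the adjoint `A^* : Y^* → X^*`, `f ↦ f ∘ A`, of the
closed unit ball of `Y^*`. -/
def adjointBall (A : X →L[𝕜] Y) : Set (StrongDual 𝕜 X) :=
  (fun f : StrongDual 𝕜 Y => f.comp A) '' Metric.closedBall (0 : StrongDual 𝕜 Y) 1

/-- The Szlenk index `Sz(A) = Sz(A^* B_{Y^*})` of an operator `A : X → Y`. -/
def opIndex (A : X →L[𝕜] Y) : WithTop Ordinal.{v} :=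
  index.{u, v, w} (adjointBall A)

end Derivation

/-- A class of (bounded linear) operators between Banach spaces over `𝕜`, given by its
components `I(X, Y) ⊆ L(X, Y)`. -/
def OperatorClass (𝕜 : Type) [RCLike 𝕜] : Type (u + 1) :=
  ∀ (X Y : Type u) [NormedAddCommGroup X] [NormedSpace 𝕜 X] [CompleteSpace X]
    [NormedAddCommGroup Y] [NormedSpace 𝕜 Y] [CompleteSpace Y], Set (X →L[𝕜] Y)

/-- A class of operators is an operator ideal if it is stable under composition with arbitrary
operators on both sides, contains the identity of the scalar field (regarded as a Banach space in
the universe at hand) and has linear subspaces as its components. -/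
structure IsOperatorIdeal {𝕜 : Type} [RCLike 𝕜] (I : OperatorClass.{u} 𝕜) : Prop where
  comp_mem : ∀ (W X Y Z : Type u)
    [NormedAddCommGroup W] [NormedSpace 𝕜 W] [CompleteSpace W]
    [NormedAddCommGroup X] [NormedSpace 𝕜 X] [CompleteSpace X]
    [NormedAddCommGroup Y] [NormedSpace 𝕜 Y] [CompleteSpace Y]
    [NormedAddCommGroup Z] [NormedSpace 𝕜 Z] [CompleteSpace Z]
    (C : W →L[𝕜] X) (B : X →L[𝕜] Y) (A : Y →L[𝕜] Z), B ∈ I X Y → A ∘L B ∘L C ∈ I W Z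
  id_mem : ContinuousLinearMap.id 𝕜 (ULift.{u} 𝕜) ∈ I (ULift.{u} 𝕜) (ULift.{u} 𝕜)
  isSubspace : ∀ (X Y : Type u)
    [NormedAddCommGroup X] [NormedSpace 𝕜 X] [CompleteSpace X]
    [NormedAddCommGroup Y] [NormedSpace 𝕜 Y] [CompleteSpace Y],
    ∃ S : Submodule 𝕜 (X →L[𝕜] Y), (S : Set (X →L[𝕜] Y)) = I X Y

/-- An operator ideal is closed if each `I(X, Y)` is closed in `L(X, Y)` for the operator norm. -/
structure IsClosedOperatorIdeal {𝕜 : Type} [RCLike 𝕜] (I : OperatorClass.{u} 𝕜) : Prop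
    extends IsOperatorIdeal I where
  isClosed : ∀ (X Y : Type u)
    [NormedAddCommGroup X] [NormedSpace 𝕜 X] [CompleteSpace X]
    [NormedAddCommGroup Y] [NormedSpace 𝕜 Y] [CompleteSpace Y], IsClosed (I X Y)

/-- The class of all operators `A` with `Sz(A) ≤ ω^ξ`. -/
def szlenkClass (𝕜 : Type) [RCLike 𝕜] (ξ : Ordinal.{v}) : OperatorClass.{u} 𝕜 :=
  fun X Y _ _ _ _ _ _ =>
    {A : X →L[𝕜] Y | opIndex.{u, v, 0} A ≤ ((ω ^ ξ : Ordinal.{v}) : WithTop Ordinal.{v})}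

end Szlenk

end

/-!
The condition `Sz(K) ≤ θ` says exactly that at every scale the points of `K` carry ordinal ranks
below `θ` which are weak* upper semicontinuous and for which nearby points of equal rank are
norm-close: for one direction, rank a point by the stage at which the derivation removes it; for
the other, a point surviving `ζ` derivations has rank at least `ζ`. Such ranks pull back along
continuous maps, push forward along a continuous map on a compact set by taking the maximum over
each fibre, and persist under uniform limits. Hence `Sz(A) ≤ θ` can be tested for the adjoint of `A`
on the weak*-compact dual ball, where composition and norm limits are harmless. Sums are handled by
the natural (Hessenberg) sum of the two ranks, which is strictly monotone in each argument, and
`ω ^ ξ` is closed under natural sums.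
-/

noncomputable section

open Set Topology Filter Uniformity
open scoped Ordinal

namespace Szlenk

section NaturalSum

instance small_Iio_prod (p : Ordinal.{v} × Ordinal.{v}) : Small.{v} (Iio p) :=
  have hsub : Iio p ⊆ Iic p.1 ×ˢ Iic p.2 := fun _ hq => le_of_lt (mem_Iio.1 hq)
  small_subset hsub

/-- The natural (Hessenberg) sum of two ordinals, encoded as the rank of the pair `(a, b)` in the
well-founded product order on pairs of ordinals. -/
def naturalSum (a b : Ordinal.{v}) : Ordinal.{v} :=
  ⨆ q : Iio (a, b), naturalSum q.1.1 q.1.2 + 1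
termination_by toLex (a, b)
decreasing_by exact Prod.Lex.toLex_strictMono q.2

theorem naturalSum_le_iff {a b c : Ordinal.{v}} :
    naturalSum a b ≤ c ↔ ∀ a' b', (a', b') < (a, b) → naturalSum a' b' < c := by
  rw [naturalSum, Ordinal.iSup_le_iff]
  simp only [Order.add_one_le_iff, Subtype.forall, Prod.forall, mem_Iio]

theorem strictMono_naturalSum :
    StrictMono fun p : Ordinal.{v} × Ordinal.{v} => naturalSum p.1 p.2 :=
  fun p _ h => naturalSum_le_iff.1 le_rfl p.1 p.2 h

theorem naturalSum_natCast_le (m n : ℕ) :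
    naturalSum (m : Ordinal.{v}) n ≤ (m + n : ℕ) := by
  induction hk : m + n using Nat.strong_induction_on generalizing m n with
  | _ k ih =>
    refine naturalSum_le_iff.2 fun a' b' h => ?_
    obtain ⟨m', rfl⟩ := Ordinal.lt_omega0.1 (h.le.1.trans_lt (Ordinal.natCast_lt_omega0 m))
    obtain ⟨n', rfl⟩ := Ordinal.lt_omega0.1 (h.le.2.trans_lt (Ordinal.natCast_lt_omega0 n))
    have hlt : m' + n' < k := by
      simp only [Prod.mk_lt_mk, Nat.cast_lt, Nat.cast_le] at h
      omega
    exact (ih _ hlt m' n' rfl).trans_lt (by exact_mod_cast hlt)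

theorem isPrincipal_naturalSum_omega0 : Ordinal.IsPrincipal naturalSum (ω : Ordinal.{v}) := by
  intro a b ha hb
  obtain ⟨m, rfl⟩ := Ordinal.lt_omega0.1 ha
  obtain ⟨n, rfl⟩ := Ordinal.lt_omega0.1 hb
  exact (naturalSum_natCast_le m n).trans_lt (Ordinal.natCast_lt_omega0 _)

theorem naturalSum_le_mul_add {d : Ordinal.{v}} (hd₀ : d ≠ 0)
    (hd : Ordinal.IsPrincipal naturalSum d) (a b : Ordinal.{v}) :
    naturalSum a b ≤ d * naturalSum (a / d) (b / d) + naturalSum (a % d) (b % d) := by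
  refine naturalSum_le_iff.2 fun a' b' h => (naturalSum_le_mul_add hd₀ hd a' b').trans_lt ?_
  have hquot : (a' / d, b' / d) ≤ (a / d, b / d) :=
    ⟨Ordinal.div_le_left h.le.1 d, Ordinal.div_le_left h.le.2 d⟩
  rcases hquot.eq_or_lt with heq | hlt
  · obtain ⟨ha, hb⟩ := Prod.mk.inj heq
    have hrem : (a' % d, b' % d) < (a % d, b % d) := by
      rw [← Ordinal.div_add_mod a' d, ← Ordinal.div_add_mod b' d, ← Ordinal.div_add_mod a d,
        ← Ordinal.div_add_mod b d, ha, hb] at h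
      simpa only [Prod.mk_lt_mk, add_lt_add_iff_left, add_le_add_iff_left] using h
    rw [ha, hb]
    gcongr
    exact strictMono_naturalSum hrem
  · calc d * naturalSum (a' / d) (b' / d) + naturalSum (a' % d) (b' % d)
        < d * naturalSum (a' / d) (b' / d) + d := by
          gcongr; exact hd (Ordinal.mod_lt a' hd₀) (Ordinal.mod_lt b' hd₀)
      _ = d * (naturalSum (a' / d) (b' / d) + 1) := (mul_add_one _ _).symm
      _ ≤ d * naturalSum (a / d) (b / d) := by
          gcongr; exact Order.add_one_le_iff.2 (strictMono_naturalSum hlt)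
      _ ≤ _ := le_self_add
termination_by toLex (a, b)
decreasing_by exact Prod.Lex.toLex_strictMono h

theorem isPrincipal_naturalSum_mul {d e : Ordinal.{v}} (hd : Ordinal.IsPrincipal naturalSum d)
    (he : Ordinal.IsPrincipal naturalSum e) : Ordinal.IsPrincipal naturalSum (d * e) := by
  intro a b ha hb
  have hd₀ : d ≠ 0 := by rintro rfl; simp at ha
  calc naturalSum a b
      ≤ d * naturalSum (a / d) (b / d) + naturalSum (a % d) (b % d) :=
        naturalSum_le_mul_add hd₀ hd a b
    _ < d * naturalSum (a / d) (b / d) + d := by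
        gcongr; exact hd (Ordinal.mod_lt a hd₀) (Ordinal.mod_lt b hd₀)
    _ = d * (naturalSum (a / d) (b / d) + 1) := (mul_add_one _ _).symm
    _ ≤ d * e := by
        gcongr
        exact Order.add_one_le_iff.2 <| he ((Ordinal.lt_mul_iff_div_lt hd₀).1 ha)
          ((Ordinal.lt_mul_iff_div_lt hd₀).1 hb)

theorem isPrincipal_naturalSum_omega0_opow (ξ : Ordinal.{v}) :
    Ordinal.IsPrincipal naturalSum (ω ^ ξ) := by
  induction ξ using Ordinal.limitRecOn with
  | zero =>
    rw [Ordinal.opow_zero, Ordinal.isPrincipal_one_iff]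
    simpa using naturalSum_natCast_le 0 0
  | add_one ξ ih =>
    rw [Ordinal.opow_add_one]
    exact isPrincipal_naturalSum_mul ih isPrincipal_naturalSum_omega0
  | limit ξ hξ ih =>
    rw [Ordinal.opow_limit Ordinal.omega0_ne_zero hξ]
    exact Ordinal.IsPrincipal.iSup fun η => ih η.1 η.2

end NaturalSum

section Fragmentation

variable {T T' N M M' ι : Type*} [TopologicalSpace T] {S : Set T} {φ : T → M} {θ : Ordinal.{v}}

/-- `ρ` is an oscillation rank for `φ` on `S` at the scale `U`: it is upper semicontinuous along
`S`, and near each `t ∈ S` the values of `φ` at the points of the same rank as `t` are `U`-close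
to `φ t`. -/
def IsOscillationRank (U : Set (M × M)) (φ : T → M) (S : Set T) (ρ : T → Ordinal.{v}) : Prop :=
  ∀ t ∈ S, ∀ᶠ s in 𝓝[S] t, ρ s ≤ ρ t ∧ (ρ s = ρ t → (φ s, φ t) ∈ U)

theorem IsOscillationRank.upperSemicontinuousOn {U : Set (M × M)} {ρ : T → Ordinal.{v}}
    (hρ : IsOscillationRank U φ S ρ) : UpperSemicontinuousOn ρ S :=
  fun t ht _ hlt => (hρ t ht).mono fun _ hs => hs.1.trans_lt hlt

variable [TopologicalSpace T'] [TopologicalSpace N] [UniformSpace M] [UniformSpace M']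

/-- `φ` is fragmented on `S` with height `θ`: at every scale it has an oscillation rank with values
below `θ`. -/
def FragmentedOn (φ : T → M) (S : Set T) (θ : Ordinal.{v}) : Prop :=
  ∀ U ∈ 𝓤 M, ∃ ρ : T → Ordinal.{v}, IsOscillationRank U φ S ρ ∧ MapsTo ρ S (Iio θ)

theorem fragmentedOn_one_of_continuousOn (h : ContinuousOn φ S) :
    FragmentedOn φ S (1 : Ordinal.{v}) := by
  refine fun U hU => ⟨fun _ => 0, fun t ht => ?_, fun _ _ => mem_Iio.2 zero_lt_one⟩
  filter_upwards [h t ht (mem_nhds_right (φ t) hU)] with s hs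
  exact ⟨le_rfl, fun _ => hs⟩

theorem FragmentedOn.comp {S' : Set T'} {τ : T' → T} (hφ : FragmentedOn φ S θ)
    (hτ : ContinuousOn τ S') (hmaps : MapsTo τ S' S) : FragmentedOn (φ ∘ τ) S' θ := by
  intro U hU
  obtain ⟨ρ, hρ, hρθ⟩ := hφ U hU
  exact ⟨ρ ∘ τ, fun t ht => ((hτ t ht).tendsto_nhdsWithin hmaps).eventually (hρ _ (hmaps ht)),
    hρθ.comp hmaps⟩

theorem FragmentedOn.uniformContinuous_comp {u : M → M'} (hu : UniformContinuous u)
    (hφ : FragmentedOn φ S θ) : FragmentedOn (u ∘ φ) S θ :=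
  fun _ hU => hφ _ (hu hU)

theorem FragmentedOn.prodMk {ψ : T → M'} (hθ : Ordinal.IsPrincipal naturalSum θ)
    (hφ : FragmentedOn φ S θ) (hψ : FragmentedOn ψ S θ) :
    FragmentedOn (fun t => (φ t, ψ t)) S θ := by
  intro W hW
  obtain ⟨U, hU, V, hV, hUV⟩ := entourageProd_subset hW
  obtain ⟨ρ, hρ, hρθ⟩ := hφ U hU
  obtain ⟨σ, hσ, hσθ⟩ := hψ V hV
  refine ⟨fun t => naturalSum (ρ t) (σ t), fun t ht => ?_, fun t ht => hθ (hρθ ht) (hσθ ht)⟩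
  filter_upwards [hρ t ht, hσ t ht] with s hρs hσs
  have hle : (ρ s, σ s) ≤ (ρ t, σ t) := ⟨hρs.1, hσs.1⟩
  refine ⟨strictMono_naturalSum.monotone hle, fun hsum => hUV ?_⟩
  obtain ⟨hρeq, hσeq⟩ : ρ s = ρ t ∧ σ s = σ t :=
    Prod.mk.inj (hle.eq_of_not_lt fun hlt => (strictMono_naturalSum hlt).ne hsum)
  exact ⟨hρs.2 hρeq, hσs.2 hσeq⟩

theorem FragmentedOn.of_tendstoUniformlyOn {F : ι → T → M} {l : Filter ι}
    (hlim : TendstoUniformlyOn F φ l S) (hF : ∃ᶠ i in l, FragmentedOn (F i) S θ) :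
    FragmentedOn φ S θ := by
  intro U hU
  obtain ⟨V, hV, hVsymm, hVU⟩ := comp_comp_symm_mem_uniformity_sets hU
  obtain ⟨i, hFi, hclose⟩ := (hF.and_eventually (hlim V hV)).exists
  obtain ⟨ρ, hρ, hρθ⟩ := hFi V hV
  refine ⟨ρ, fun t ht => ?_, hρθ⟩
  filter_upwards [hρ t ht, self_mem_nhdsWithin] with s hs hsS
  exact ⟨hs.1, fun heq => hVU ⟨_, ⟨_, hclose s hsS, hs.2 heq⟩, hVsymm.symm _ _ (hclose t ht)⟩⟩

theorem eventually_nhds_forall_fiber [T2Space N] {τ : T → N} (hS : IsCompact S)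
    (hτ : Continuous τ) {z : N} {P : T → Prop}
    (hP : ∀ t ∈ S, τ t = z → ∀ᶠ s in 𝓝[S] t, P s) :
    ∀ᶠ y in 𝓝 z, ∀ s ∈ S, τ s = y → P s := by
  have : CompactSpace S := isCompact_iff_compactSpace.1 hS
  have hcont : Continuous (S.domRestrict τ) := hτ.comp continuous_subtype_val
  have hfiber : ∀ t ∈ S.domRestrict τ ⁻¹' {z}, ∀ᶠ s : S in 𝓝 t, P s := fun t ht => by
    simpa only [nhdsWithin_eq_map_subtype_coe t.2, eventually_map] using hP t t.2 ht
  filter_upwards [hcont.isClosedMap.eventually_nhds_fiber z hfiber] with y hy s hs hsy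
  exact hy ⟨s, hs⟩ hsy

/-- The rank of a point of `τ '' S` is the largest rank on its fibre, which is attained by
compactness. -/
theorem FragmentedOn.image [T2Space N] {τ : T → N} {g : N → M} (hS : IsCompact S)
    (hτ : Continuous τ) (h : FragmentedOn (g ∘ τ) S θ) : FragmentedOn g (τ '' S) θ := by
  intro U hU
  obtain ⟨ρ, hρ, hρθ⟩ := h U hU
  obtain rfl | hne := S.eq_empty_or_nonempty
  · exact ⟨0, by simp [IsOscillationRank], by simp [MapsTo]⟩
  have : Nonempty T := hne.nonempty
  have hmax : ∀ y ∈ τ '' S, ∃ t ∈ S, τ t = y ∧ ∀ s ∈ S, τ s = y → ρ s ≤ ρ t := by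
    rintro y ⟨t₀, ht₀, rfl⟩
    have hfiber : IsCompact (S ∩ τ ⁻¹' {τ t₀}) := hS.inter_right (isClosed_singleton.preimage hτ)
    obtain ⟨t, ⟨htS, hty⟩, ht⟩ := (hρ.upperSemicontinuousOn.mono inter_subset_left).exists_isMaxOn
      (s := S ∩ τ ⁻¹' {τ t₀}) ⟨t₀, ht₀, rfl⟩ hfiber
    exact ⟨t, htS, hty, fun s hs hsy => ht ⟨hs, hsy⟩⟩
  choose! m hmS hτm hm using hmax
  refine ⟨ρ ∘ m, fun z hz => ?_, fun y hy => hρθ (hmS y hy)⟩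
  have hnear : ∀ᶠ y in 𝓝 z, ∀ s ∈ S, τ s = y →
      ρ s ≤ ρ (m z) ∧ (ρ s = ρ (m z) → (g (τ s), g z) ∈ U) := by
    refine eventually_nhds_forall_fiber hS hτ fun t ht htz => ?_
    filter_upwards [hρ t ht] with s hs
    refine ⟨hs.1.trans (hm z hz t ht htz), fun heq => ?_⟩
    simpa [htz] using hs.2 (hs.1.antisymm ((hm z hz t ht htz).trans heq.ge))
  filter_upwards [nhdsWithin_le_nhds hnear, self_mem_nhdsWithin] with y hy hyS
  simpa [hτm y hyS] using hy (m y) (hmS y hyS) (hτm y hyS)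

end Fragmentation

section Derivation

variable {𝕜 : Type w} [RCLike 𝕜] {X : Type u} [NormedAddCommGroup X] [NormedSpace 𝕜 X]
  {ε : ℝ} {K : Set (StrongDual 𝕜 X)} {ζ : Ordinal.{v}}

theorem derivSet_subset (ε : ℝ) (K : Set (StrongDual 𝕜 X)) : derivSet ε K ⊆ K :=
  sep_subset _ _

theorem iterDeriv_zero (ε : ℝ) (K : Set (StrongDual 𝕜 X)) :
    iterDeriv ε K (0 : Ordinal.{v}) = K :=
  Ordinal.limitRecOn_zero ..

theorem iterDeriv_add_one (ε : ℝ) (K : Set (StrongDual 𝕜 X)) (ζ : Ordinal.{v}) :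
    iterDeriv ε K (ζ + 1) = derivSet ε (iterDeriv ε K ζ) :=
  Ordinal.limitRecOn_add_one ..

theorem iterDeriv_limit (ε : ℝ) (K : Set (StrongDual 𝕜 X)) (hζ : Order.IsSuccLimit ζ) :
    iterDeriv ε K ζ = ⋂ (η : Ordinal.{v}) (_ : η < ζ), iterDeriv ε K η :=
  Ordinal.limitRecOn_limit _ _ _ _ hζ

theorem iterDeriv_antitone (ε : ℝ) (K : Set (StrongDual 𝕜 X)) :
    Antitone (iterDeriv ε K : Ordinal.{v} → Set (StrongDual 𝕜 X)) := by
  intro η ζ h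
  induction ζ using Ordinal.limitRecOn with
  | zero => rw [nonpos_iff_eq_zero.1 h]
  | add_one ζ ih =>
    rcases h.eq_or_lt with rfl | h
    · exact le_rfl
    · rw [iterDeriv_add_one]
      exact (derivSet_subset _ _).trans (ih (Order.lt_add_one_iff.1 h))
  | limit ζ hζ _ =>
    rcases h.eq_or_lt with rfl | h
    · exact le_rfl
    · rw [iterDeriv_limit ε K hζ]
      exact iInter₂_subset η h

theorem iterDeriv_subset (ε : ℝ) (K : Set (StrongDual 𝕜 X)) (ζ : Ordinal.{v}) :
    iterDeriv ε K ζ ⊆ K :=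
  (iterDeriv_antitone ε K zero_le).trans_eq (iterDeriv_zero ε K)

theorem exists_mem_iterDeriv_notMem_add_one {x : StrongDual 𝕜 X} (hx : x ∈ K)
    (h : x ∉ iterDeriv ε K ζ) : ∃ α < ζ, x ∈ iterDeriv ε K α ∧ x ∉ iterDeriv ε K (α + 1) := by
  induction ζ using Ordinal.limitRecOn with
  | zero => exact absurd hx (by rwa [iterDeriv_zero] at h)
  | add_one ζ ih =>
    by_cases hζ : x ∈ iterDeriv ε K ζ
    · exact ⟨ζ, lt_add_one ζ, hζ, h⟩
    · obtain ⟨α, hα, hmem⟩ := ih hζ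
      exact ⟨α, hα.trans (lt_add_one ζ), hmem⟩
  | limit ζ hζ ih =>
    simp only [iterDeriv_limit ε K hζ, mem_iInter, not_forall] at h
    obtain ⟨η, hη, hxη⟩ := h
    obtain ⟨α, hα, hmem⟩ := ih η hη hxη
    exact ⟨α, hα.trans hη, hmem⟩

theorem eventually_notMem_derivSet {x : StrongDual 𝕜 X} (hx : x ∈ K) (h : x ∉ derivSet ε K) :
    ∀ᶠ y in 𝓝 (StrongDual.toWeakDual x), WeakDual.toStrongDual y ∉ derivSet ε K ∧
      (WeakDual.toStrongDual y ∈ K → dist (WeakDual.toStrongDual y) x ≤ ε) := by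
  obtain ⟨hε, V, hV, hdiam⟩ : 0 < ε ∧ ∃ V ∈ 𝓝 (StrongDual.toWeakDual x),
      Metric.ediam (StrongDual.toWeakDual ⁻¹' V ∩ K) ≤ ENNReal.ofReal ε := by
    simpa only [derivSet, mem_ofPred_eq, hx, true_and, not_forall, not_lt, exists_prop] using h
  filter_upwards [eventually_mem_nhds_iff.2 hV] with y hy
  refine ⟨fun hmem => (hmem.2 hε V hy).not_ge hdiam, fun hyK => ?_⟩
  have hyV : y ∈ V := mem_of_mem_nhds hy
  have hxV : StrongDual.toWeakDual x ∈ V := mem_of_mem_nhds hV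
  have hedist : edist (WeakDual.toStrongDual y) x ≤ ENNReal.ofReal ε :=
    Metric.edist_le_of_ediam_le (mem_inter hyV hyK) (mem_inter hxV hx) hdiam
  rwa [edist_dist, ENNReal.ofReal_le_ofReal_iff hε.le] at hedist

theorem exists_isOscillationRank_of_iterDeriv_eq_empty (h : iterDeriv ε K ζ = ∅) :
    ∃ ρ : WeakDual 𝕜 X → Ordinal.{v},
      IsOscillationRank {p | dist p.1 p.2 ≤ ε} WeakDual.toStrongDual (WeakDual.toStrongDual ⁻¹' K) ρ
        ∧ MapsTo ρ (WeakDual.toStrongDual ⁻¹' K) (Iio ζ) := by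
  have hrank : ∀ x ∈ WeakDual.toStrongDual ⁻¹' K, ∃ α < ζ,
      WeakDual.toStrongDual x ∈ iterDeriv ε K α ∧
        WeakDual.toStrongDual x ∉ iterDeriv ε K (α + 1) :=
    fun x hx => exists_mem_iterDeriv_notMem_add_one hx (h ▸ notMem_empty _)
  choose! ρ hρζ hmem hnotMem using hrank
  refine ⟨ρ, fun x hx => ?_, hρζ⟩
  have hnear := eventually_notMem_derivSet (hmem x hx) (iterDeriv_add_one ε K _ ▸ hnotMem x hx)
  filter_upwards [nhdsWithin_le_nhds hnear, self_mem_nhdsWithin] with y hy hyK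
  rw [← iterDeriv_add_one] at hy
  refine ⟨?_, fun heq => hy.2 (heq ▸ hmem y hyK)⟩
  by_contra! hlt
  exact hy.1 (iterDeriv_antitone ε K (Order.add_one_le_iff.2 hlt) (hmem y hyK))

theorem le_of_mem_iterDeriv_of_isOscillationRank {δ : ℝ} (hε : 0 < ε) (hδ : 2 * δ ≤ ε)
    {ρ : WeakDual 𝕜 X → Ordinal.{v}}
    (hρ : IsOscillationRank {p | dist p.1 p.2 ≤ δ} WeakDual.toStrongDual
      (WeakDual.toStrongDual ⁻¹' K) ρ)
    {x : StrongDual 𝕜 X} (hx : x ∈ iterDeriv ε K ζ) : ζ ≤ ρ (StrongDual.toWeakDual x) := by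
  induction ζ using Ordinal.limitRecOn generalizing x with
  | zero => exact zero_le
  | add_one ζ ih =>
    by_contra! hlt
    have hxK : x ∈ K := iterDeriv_subset ε K _ hx
    rw [iterDeriv_add_one] at hx
    have hxζ : ρ (StrongDual.toWeakDual x) = ζ := (Order.lt_add_one_iff.1 hlt).antisymm (ih hx.1)
    obtain ⟨V, hV, hVρ⟩ := (eventually_nhdsWithin_iff.1 (hρ _ hxK)).exists_mem
    have hclose : ∀ y ∈ StrongDual.toWeakDual ⁻¹' V ∩ iterDeriv ε K ζ, dist y x ≤ δ := by
      rintro y ⟨hyV, hyζ⟩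
      obtain ⟨hle, heq⟩ := hVρ _ hyV (iterDeriv_subset ε K ζ hyζ)
      exact heq (hle.antisymm (hxζ.trans_le (ih hyζ)))
    refine (hx.2 hε V hV).not_ge (Metric.ediam_le_of_forall_dist_le fun y hy z hz => ?_)
    linarith [dist_triangle_right y z x, hclose y hy, hclose z hz]
  | limit ζ hζ ih =>
    rw [iterDeriv_limit ε K hζ] at hx
    exact le_of_forall_lt fun η hη =>
      (lt_add_one η).trans_le (ih _ (hζ.add_one_lt hη) (mem_iInter₂.1 hx _ (hζ.add_one_lt hη)))

theorem indexAt_le_iff : indexAt K ε ≤ (ζ : WithTop Ordinal.{v}) ↔ iterDeriv ε K ζ = ∅ := by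
  refine ⟨fun h => ?_, fun h => sInf_le ⟨ζ, h, rfl⟩⟩
  obtain ⟨_, ⟨η, hη, rfl⟩, hlt⟩ :=
    sInf_lt_iff.1 (h.trans_lt (WithTop.coe_lt_coe.2 (lt_add_one ζ)))
  have hηζ : η ≤ ζ := Order.lt_add_one_iff.1 (WithTop.coe_lt_coe.1 hlt)
  exact subset_eq_empty (iterDeriv_antitone ε K hηζ) hη

theorem index_le_iff_fragmentedOn : index K ≤ (ζ : WithTop Ordinal.{v}) ↔
    FragmentedOn (WeakDual.toStrongDual : WeakDual 𝕜 X → StrongDual 𝕜 X)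
      (WeakDual.toStrongDual ⁻¹' K) ζ := by
  simp only [index, iSup_le_iff, indexAt_le_iff]
  constructor
  · intro h U hU
    obtain ⟨ε, hε, hεU⟩ := Metric.uniformity_basis_dist_le.mem_iff.1 hU
    obtain ⟨ρ, hρ, hρζ⟩ := exists_isOscillationRank_of_iterDeriv_eq_empty (h ε hε)
    exact ⟨ρ, fun t ht => (hρ t ht).mono fun s hs => ⟨hs.1, fun heq => hεU (hs.2 heq)⟩, hρζ⟩
  · intro h ε hε
    obtain ⟨ρ, hρ, hρζ⟩ := h _ (Metric.uniformity_basis_dist_le.mem_of_mem (half_pos hε))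
    refine eq_empty_of_forall_notMem fun x hx => ?_
    have hxK : x ∈ K := iterDeriv_subset ε K _ hx
    exact (hρζ (x := StrongDual.toWeakDual x) hxK).not_ge
      (le_of_mem_iterDeriv_of_isOscillationRank hε (by linarith) hρ hx)

end Derivation

section Operators

variable {𝕜 : Type w} [RCLike 𝕜] {W X Y Z : Type u}
  [NormedAddCommGroup W] [NormedSpace 𝕜 W] [NormedAddCommGroup X] [NormedSpace 𝕜 X]
  [NormedAddCommGroup Y] [NormedSpace 𝕜 Y] [NormedAddCommGroup Z] [NormedSpace 𝕜 Z]
  {θ : Ordinal.{v}}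

/-- The closed unit ball of the dual of `Y`, as a subset of the weak* dual. -/
def weakDualBall (𝕜 : Type w) [RCLike 𝕜] (Y : Type u) [NormedAddCommGroup Y] [NormedSpace 𝕜 Y] :
    Set (WeakDual 𝕜 Y) :=
  WeakDual.toStrongDual ⁻¹' Metric.closedBall (0 : StrongDual 𝕜 Y) 1

/-- The adjoint `f ↦ f ∘ A` as a weak*-to-weak* continuous operator. -/
def weakAdjoint (A : X →L[𝕜] Y) : WeakDual 𝕜 Y →L[𝕜] WeakDual 𝕜 X where
  toFun f := StrongDual.toWeakDual ((WeakDual.toStrongDual f).comp A)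
  map_add' _ _ := rfl
  map_smul' _ _ := rfl
  cont := WeakDual.continuous_of_continuous_eval fun x => WeakDual.eval_continuous (A x)

theorem mem_weakDualBall {f : WeakDual 𝕜 Y} :
    f ∈ weakDualBall 𝕜 Y ↔ ‖WeakDual.toStrongDual f‖ ≤ 1 :=
  mem_closedBall_zero_iff

theorem norm_toStrongDual_weakAdjoint_le (A : X →L[𝕜] Y) {f : WeakDual 𝕜 Y}
    (hf : f ∈ weakDualBall 𝕜 Y) : ‖WeakDual.toStrongDual (weakAdjoint A f)‖ ≤ ‖A‖ :=
  ((WeakDual.toStrongDual f).opNorm_comp_le A).trans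
    (mul_le_of_le_one_left (norm_nonneg A) (mem_weakDualBall.1 hf))

theorem isCompact_weakDualBall : IsCompact (weakDualBall 𝕜 Y) :=
  WeakDual.isCompact_closedBall 0 1

theorem toStrongDual_preimage_adjointBall (A : X →L[𝕜] Y) :
    WeakDual.toStrongDual ⁻¹' adjointBall A = weakAdjoint A '' weakDualBall 𝕜 Y :=
  rfl

theorem opIndex_le_iff_fragmentedOn {A : X →L[𝕜] Y} :
    opIndex A ≤ (θ : WithTop Ordinal.{v}) ↔
      FragmentedOn (WeakDual.toStrongDual ∘ weakAdjoint A) (weakDualBall 𝕜 Y) θ := by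
  rw [opIndex, index_le_iff_fragmentedOn, toStrongDual_preimage_adjointBall]
  exact ⟨fun h => h.comp (weakAdjoint A).continuous.continuousOn (mapsTo_image _ _),
    fun h => h.image isCompact_weakDualBall (weakAdjoint A).continuous⟩

/-- The adjoint of `A ∘ B ∘ C` is `(a • C*) ∘ B* ∘ (a⁻¹ • A*)` for any scalar `a` of norm larger
than `‖A‖`, and then `a⁻¹ • A*` maps the dual ball into the dual ball. -/
theorem opIndex_comp_comp_le (C : W →L[𝕜] X) (B : X →L[𝕜] Y) (A : Y →L[𝕜] Z) :
    opIndex.{u, v} (A ∘L B ∘L C) ≤ opIndex B := by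
  induction hB : opIndex.{u, v} B with
  | top => exact le_top
  | coe θ =>
  obtain ⟨a, ha⟩ := NormedField.exists_lt_norm 𝕜 ‖A‖
  have ha₀ : a ≠ 0 := norm_pos_iff.1 ((norm_nonneg A).trans_lt ha)
  let T : WeakDual 𝕜 Z →L[𝕜] WeakDual 𝕜 Y := a⁻¹ • weakAdjoint A
  let R : StrongDual 𝕜 X →L[𝕜] StrongDual 𝕜 W := a • ContinuousLinearMap.precomp 𝕜 C
  have hmaps : MapsTo T (weakDualBall 𝕜 Z) (weakDualBall 𝕜 Y) := by
    intro f hf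
    have hle := (norm_toStrongDual_weakAdjoint_le A hf).trans ha.le
    rw [mem_weakDualBall]
    calc ‖WeakDual.toStrongDual (T f)‖
        = ‖a‖⁻¹ * ‖WeakDual.toStrongDual (weakAdjoint A f)‖ := by
          rw [← norm_inv]; exact norm_smul a⁻¹ (WeakDual.toStrongDual (weakAdjoint A f))
      _ ≤ 1 := inv_mul_le_one_of_le₀ hle (norm_nonneg a)
  have hfactor : WeakDual.toStrongDual ∘ weakAdjoint (A ∘L B ∘L C) =
      R ∘ (WeakDual.toStrongDual ∘ weakAdjoint B) ∘ T := by
    ext f x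
    exact (mul_inv_cancel_left₀ ha₀ (f (A (B (C x))))).symm
  rw [opIndex_le_iff_fragmentedOn, hfactor]
  exact ((opIndex_le_iff_fragmentedOn.1 hB.le).comp
    T.continuous.continuousOn hmaps).uniformContinuous_comp R.uniformContinuous

theorem opIndex_smul_le (c : 𝕜) (A : X →L[𝕜] Y) : opIndex.{u, v} (c • A) ≤ opIndex A := by
  simpa using opIndex_comp_comp_le (ContinuousLinearMap.id 𝕜 X) A
    (c • ContinuousLinearMap.id 𝕜 Y)

theorem opIndex_add_le {A B : X →L[𝕜] Y} (hθ : Ordinal.IsPrincipal naturalSum θ)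
    (hA : opIndex A ≤ (θ : WithTop Ordinal.{v})) (hB : opIndex B ≤ (θ : WithTop Ordinal.{v})) :
    opIndex (A + B) ≤ (θ : WithTop Ordinal.{v}) := by
  rw [opIndex_le_iff_fragmentedOn] at hA hB ⊢
  convert (hA.prodMk hθ hB).uniformContinuous_comp uniformContinuous_add using 1
  ext f x
  exact map_add (WeakDual.toStrongDual f) (A x) (B x)

theorem opIndex_zero_le_one : opIndex.{u, v} (0 : X →L[𝕜] Y) ≤ 1 := by
  have hzero : WeakDual.toStrongDual ∘ weakAdjoint (0 : X →L[𝕜] Y) = fun _ => 0 := by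
    ext f _
    exact map_zero (WeakDual.toStrongDual f)
  refine opIndex_le_iff_fragmentedOn.2 (fragmentedOn_one_of_continuousOn ?_)
  exact hzero ▸ continuousOn_const

theorem continuous_toStrongDual_of_finiteDimensional [FiniteDimensional 𝕜 X] :
    Continuous (WeakDual.toStrongDual : WeakDual 𝕜 X → StrongDual 𝕜 X) := by
  have : FiniteDimensional 𝕜 (WeakDual 𝕜 X) :=
    (StrongDual.toWeakDual : StrongDual 𝕜 X ≃ₗ[𝕜] WeakDual 𝕜 X).finiteDimensional
  exact LinearMap.continuous_of_finiteDimensional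
    (WeakDual.toStrongDual : WeakDual 𝕜 X ≃ₗ[𝕜] StrongDual 𝕜 X).toLinearMap

theorem opIndex_le_one_of_finiteDimensional [FiniteDimensional 𝕜 X] (A : X →L[𝕜] Y) :
    opIndex.{u, v} A ≤ 1 :=
  opIndex_le_iff_fragmentedOn.2 <| fragmentedOn_one_of_continuousOn <|
    (continuous_toStrongDual_of_finiteDimensional.comp (weakAdjoint A).continuous).continuousOn

theorem tendstoUniformlyOn_weakAdjoint (A : X →L[𝕜] Y) :
    TendstoUniformlyOn (fun B : X →L[𝕜] Y => WeakDual.toStrongDual ∘ weakAdjoint B)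
      (WeakDual.toStrongDual ∘ weakAdjoint A) (𝓝 A) (weakDualBall 𝕜 Y) := by
  refine Metric.tendstoUniformlyOn_iff.2 fun ε hε => ?_
  filter_upwards [Metric.ball_mem_nhds A hε] with B hB f hf
  have hsub : WeakDual.toStrongDual (weakAdjoint A f) - WeakDual.toStrongDual (weakAdjoint B f) =
      WeakDual.toStrongDual (weakAdjoint (A - B) f) :=
    ((WeakDual.toStrongDual f).comp_sub A B).symm
  calc dist (WeakDual.toStrongDual (weakAdjoint A f)) (WeakDual.toStrongDual (weakAdjoint B f))
      ≤ ‖A - B‖ := by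
        rw [dist_eq_norm, hsub]; exact norm_toStrongDual_weakAdjoint_le _ hf
    _ < ε := by rwa [← dist_eq_norm, dist_comm]

theorem isClosed_setOf_opIndex_le (θ : Ordinal.{v}) :
    IsClosed {A : X →L[𝕜] Y | opIndex A ≤ (θ : WithTop Ordinal.{v})} := by
  simp only [opIndex_le_iff_fragmentedOn]
  exact isClosed_iff_frequently.2 fun A hA =>
    FragmentedOn.of_tendstoUniformlyOn (tendstoUniformlyOn_weakAdjoint A) hA

end Operators

end Szlenk

theorem mainTheorem11_general (𝕜 : Type w) [RCLike 𝕜] (ξ : Ordinal.{v}) :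
    (∀ (W X Y Z : Type u) [NormedAddCommGroup W] [NormedSpace 𝕜 W]
      [NormedAddCommGroup X] [NormedSpace 𝕜 X] [NormedAddCommGroup Y] [NormedSpace 𝕜 Y]
      [NormedAddCommGroup Z] [NormedSpace 𝕜 Z] (C : W →L[𝕜] X) (B : X →L[𝕜] Y) (A : Y →L[𝕜] Z),
      Szlenk.opIndex B ≤ ((ω ^ ξ : Ordinal.{v}) : WithTop Ordinal.{v}) →
        Szlenk.opIndex (A ∘L B ∘L C) ≤ ((ω ^ ξ : Ordinal.{v}) : WithTop Ordinal.{v})) ∧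
    (∀ (X : Type u) [NormedAddCommGroup X] [NormedSpace 𝕜 X] [FiniteDimensional 𝕜 X],
      Szlenk.opIndex (ContinuousLinearMap.id 𝕜 X) ≤
        ((ω ^ ξ : Ordinal.{v}) : WithTop Ordinal.{v})) ∧
    ∀ (X Y : Type u) [NormedAddCommGroup X] [NormedSpace 𝕜 X]
      [NormedAddCommGroup Y] [NormedSpace 𝕜 Y],
      (∃ S : Submodule 𝕜 (X →L[𝕜] Y), (S : Set (X →L[𝕜] Y)) =
        {A | Szlenk.opIndex A ≤ ((ω ^ ξ : Ordinal.{v}) : WithTop Ordinal.{v})}) ∧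
      IsClosed {A : X →L[𝕜] Y |
        Szlenk.opIndex A ≤ ((ω ^ ξ : Ordinal.{v}) : WithTop Ordinal.{v})} := by
  have hone : (1 : WithTop Ordinal.{v}) ≤ ((ω ^ ξ : Ordinal.{v}) : WithTop Ordinal.{v}) :=
    WithTop.coe_le_coe.2 (Order.one_le_iff_pos.2 (Ordinal.opow_pos ξ Ordinal.omega0_pos))
  refine ⟨fun W X Y Z _ _ _ _ _ _ _ _ C B A => (Szlenk.opIndex_comp_comp_le C B A).trans,
    fun X _ _ _ => (Szlenk.opIndex_le_one_of_finiteDimensional _).trans hone,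
    fun X Y _ _ _ _ => ⟨⟨{
      carrier := {A | Szlenk.opIndex A ≤ ((ω ^ ξ : Ordinal.{v}) : WithTop Ordinal.{v})}
      add_mem' := Szlenk.opIndex_add_le (Szlenk.isPrincipal_naturalSum_omega0_opow ξ)
      zero_mem' := Szlenk.opIndex_zero_le_one.trans hone
      smul_mem' := fun c A => (Szlenk.opIndex_smul_le c A).trans },
      rfl⟩, Szlenk.isClosed_setOf_opIndex_le _⟩⟩

end

theorem mainTheorem11 (𝕜 : Type) [RCLike 𝕜] (ξ : Ordinal.{v}) :
    Szlenk.IsClosedOperatorIdeal.{u} (Szlenk.szlenkClass.{u, v} 𝕜 ξ) := by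
  obtain ⟨hcomp, hid, hsub⟩ := mainTheorem11_general.{u, v, 0} 𝕜 ξ
  have := (ULift.moduleEquiv (R := 𝕜) (M := 𝕜)).symm.finiteDimensional
  exact {
    comp_mem W X Y Z _ _ _ _ _ _ _ _ _ _ _ _ := hcomp W X Y Z
    id_mem := hid (ULift.{u} 𝕜)
    isSubspace X Y _ _ _ _ _ _ := (hsub X Y).1
    isClosed X Y _ _ _ _ _ _ := (hsub X Y).2 }
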